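/- For a ring $R$ let $S(R)=\{a^2 : a\in R\}$ be its set of squares and, for $n\in\mathbb{N}$, let $$N_n(R)=\inf\{\,|A+A| : A\subseteq S(R),\ |A|=n\,\},\qquad A+A=\{a+b : a,b\in A\}.$$ **Theorem.** Let $n\ge 1$ be an integer and let $p$ be a prime number with $$p>2^{2^{2^{2^{2^{9+n}}}}}.$$ Then $N_n(\mathbb{Z}/p\mathbb{Z})=2n-1$. -/

import Mathlib

open scoped Pointwise

/-- The set `S(R) = {a ^ 2 | a ∈ R}` of squares of a ring `R` (zero included). -/
def squareSet (R : Type*) [Ring R] : Set R :=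
  {x : R | ∃ a : R, x = a ^ 2}

/-- `N_n(R)`, the infimum of `|A + A|` over all `n`-element sets `A` of squares of `R`. It is taken
in `ℕ∞`, so that it is `⊤` if `R` has fewer than `n` squares, and is otherwise an attained
minimum. -/
noncomputable def minSumsetOfSquares (n : ℕ) (R : Type*) [Ring R] : ℕ∞ :=
  ⨅ A ∈ {A : Set R | A ⊆ squareSet R ∧ A.encard = (n : ℕ∞)}, (A + A).encard

/-! The lower bound is Cauchy–Davenport. For the upper bound it suffices to find `n` consecutive
squares `x + 1, …, x + n`, and `2 ^ (5 * n + 4) < p` is enough for that. If no such `x` exists,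
expanding `∑ x, ∏ b, (1 + χ (x - b))` with `χ` the quadratic character forces the terms of nonempty
`S` to add up to `-p`. Each of these fewer than `2 ^ n` terms is at least `-p / 2 ^ n`, a
contradiction. Only this one-sided bound is needed. It comes from Stepanov's method
(`stepanov_bound`): a nonzero auxiliary polynomial vanishes to high order wherever `f` is a
nonsquare, so its degree limits the number of such points. -/

namespace StepanovSquares

open Polynomial

/-! ### Derivatives of products with powers of `f` -/

section Derivative

variable {F : Type*} [Field F]

/-- The operator `r ↦ c f' r + f r'`. -/
noncomputable def weightedDerivative (f : F[X]) (c : F) : F[X] →ₗ[F] F[X] :=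
  LinearMap.mulLeft F (C c * derivative f) + LinearMap.mulLeft F f ∘ₗ derivative

/-- The iterates `L_{c-i+1} ∘ ⋯ ∘ L_c` of the operators `L_c = weightedDerivative f c`. -/
noncomputable def weightedDerivativeIter (f : F[X]) (c : F) : ℕ → F[X] →ₗ[F] F[X]
  | 0 => LinearMap.id
  | i + 1 => weightedDerivative f (c - i) ∘ₗ weightedDerivativeIter f c i

lemma weightedDerivative_apply (f : F[X]) (c : F) (r : F[X]) :
    weightedDerivative f c r = C c * derivative f * r + f * derivative r := rfl

lemma mul_mem_degreeLT {q r : F[X]} {k m : ℕ} (hq : q.natDegree ≤ m) (hr : r ∈ degreeLT F k) :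
    q * r ∈ degreeLT F (k + m) := by
  rw [mem_degreeLT] at hr ⊢
  rcases eq_or_ne r 0 with rfl | hr0
  · simp
  rcases eq_or_ne q 0 with rfl | hq0
  · simp
  rw [degree_eq_natDegree hr0] at hr
  rw [degree_eq_natDegree (mul_ne_zero hq0 hr0), natDegree_mul hq0 hr0]
  norm_cast at hr ⊢
  omega

lemma derivative_mem_degreeLT {r : F[X]} {k : ℕ} (hr : r ∈ degreeLT F k) :
    derivative r ∈ degreeLT F k := by
  rw [mem_degreeLT] at hr ⊢
  exact (degree_derivative_le).trans_lt hr

lemma weightedDerivativeIter_mem_degreeLT {f : F[X]} {m : ℕ} (hf : f.natDegree ≤ m) (c : F)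
    {r : F[X]} {d : ℕ} (hr : r ∈ degreeLT F d) (i : ℕ) :
    weightedDerivativeIter f c i r ∈ degreeLT F (d + i * m) := by
  induction i with
  | zero => simpa [weightedDerivativeIter] using hr
  | succ i ih =>
    have e : d + (i + 1) * m = d + i * m + m := by ring
    rw [e, weightedDerivativeIter, LinearMap.comp_apply, weightedDerivative_apply]
    refine add_mem (mul_mem_degreeLT ?_ ih) (mul_mem_degreeLT hf (derivative_mem_degreeLT ih))
    exact (natDegree_C_mul_le _ _).trans ((natDegree_derivative_le f).trans (by omega))

/-- The hypothesis says that `G` behaves like `f ^ a` under differentiation. It covers both `X ^ (p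
* j)` (`a = 0`) and `f ^ h * X ^ (p * j)` (`a = h`). -/
lemma iterate_derivative_pow_mul {f G : F[X]} {a : F}
    (hG : f * derivative G = C a * derivative f * G) (r : F[X]) (k i : ℕ) :
    derivative^[i] (f ^ (k + i) * r * G) =
      f ^ k * weightedDerivativeIter f ((k + i : ℕ) + a) i r * G := by
  induction i generalizing k with
  | zero => simp [weightedDerivativeIter]
  | succ i ih =>
    have e : k + (i + 1) = (k + 1) + i := by ring
    rw [Function.iterate_succ_apply', e, ih (k + 1), weightedDerivativeIter,
      LinearMap.comp_apply, weightedDerivative_apply]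
    set R := weightedDerivativeIter f (((k + 1 + i : ℕ) : F) + a) i r
    have e2 : (C (((k + 1 + i : ℕ) : F) + a - i) : F[X]) = (k : F[X]) + 1 + C a := by
      rw [← C_eq_natCast, ← C_1, ← C_add, ← C_add]
      congr 1
      push_cast
      ring
    rw [e2]
    simp only [derivative_mul, derivative_pow, Nat.add_sub_cancel, C_eq_natCast]
    push_cast
    linear_combination f ^ k * R * hG

end Derivative

/-! ### Linear algebra for the auxiliary polynomial -/

lemma exists_ne_zero_forall_eq_zero {F V : Type*} [Field F] [AddCommGroup V] [Module F V]
    [FiniteDimensional F V] {ℓ e : ℕ} (T : Fin ℓ → V →ₗ[F] F[X])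
    (hT : ∀ i v, T i v ∈ degreeLT F e) (h : ℓ * e < Module.finrank F V) :
    ∃ v : V, v ≠ 0 ∧ ∀ i, T i v = 0 := by
  let Φ : V →ₗ[F] (Fin ℓ → Fin e → F) :=
    LinearMap.pi fun i => (degreeLTEquiv F e).toLinearMap ∘ₗ (T i).codRestrict _ (hT i)
  have hker : LinearMap.ker Φ ≠ ⊥ := by
    apply LinearMap.ker_ne_bot_of_finrank_lt
    simpa [Module.finrank_pi_fintype] using h
  obtain ⟨v, hv, hv0⟩ := Submodule.exists_mem_ne_zero_of_ne_bot hker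
  refine ⟨v, hv0, fun i => ?_⟩
  have h1 : degreeLTEquiv F e ((T i).codRestrict _ (hT i) v) = 0 :=
    congrFun (LinearMap.mem_ker.mp hv) i
  rw [LinearEquiv.map_eq_zero_iff] at h1
  exact congrArg Subtype.val h1

/-- Modulo `X ^ p` only the block `u 0` survives, so it vanishes; divide by `X ^ p` and repeat. -/
lemma eq_zero_of_sum_X_pow_mul_eq_zero {F : Type*} [Field F] {p J : ℕ} (u : Fin J → F[X])
    (hu : ∀ j, X ^ p ∣ u j → u j = 0) (h : ∑ j : Fin J, X ^ (p * (j : ℕ)) * u j = 0) (j : Fin J) :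
    u j = 0 := by
  induction J with
  | zero => exact j.elim0
  | succ J ih =>
    have e : ∀ i : Fin J, (X ^ (p * ((i.succ : Fin (J + 1)) : ℕ)) * u i.succ : F[X]) =
        X ^ p * (X ^ (p * (i : ℕ)) * u i.succ) := by
      intro i
      rw [Fin.val_succ]
      ring
    rw [Fin.sum_univ_succ, Finset.sum_congr rfl (fun i _ => e i), ← Finset.mul_sum] at h
    simp only [Fin.val_zero, mul_zero, pow_zero, one_mul] at h
    have h0 : u 0 = 0 := by
      refine hu 0 ?_
      rw [eq_neg_of_add_eq_zero_left h, dvd_neg]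
      exact dvd_mul_right _ _
    rw [h0, zero_add] at h
    have h' := (mul_eq_zero.mp h).resolve_left (pow_ne_zero _ X_ne_zero)
    refine Fin.cases h0 (fun i => ?_) j
    exact ih (fun i => u i.succ) (fun i => hu i.succ) h' i

/-! ### Stepanov's method -/

section Stepanov

variable {p : ℕ} [Fact p.Prime]

lemma X_pow_dvd_pow_sub_C (f : (ZMod p)[X]) : X ^ p ∣ f ^ p - C (f.eval 0) := by
  have h1 : f ^ p - C (f.eval 0) = (f - C (f.eval 0)) ^ p := by
    rw [sub_pow_char, ← C_pow, ZMod.pow_card]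
  rw [h1]
  refine pow_dvd_pow_of_dvd ?_ p
  rw [X_dvd_iff, coeff_zero_eq_eval_zero]
  simp

/-- Multiplying by the conjugate `(r - s * f ^ h) * f` and using `f ^ p ≡ f(0)` modulo `X ^ p` gives
`f * r ^ 2 ≡ f(0) * s ^ 2`. Degrees below `p` make this an equality, and the simple root `a` gives
the two sides multiplicities of opposite parity. -/
lemma eq_zero_of_X_pow_dvd {f r s : (ZMod p)[X]} {a : ZMod p} {d h : ℕ} (hp : p = 2 * h + 1)
    (hf0 : f.eval 0 ≠ 0) (ha : f.rootMultiplicity a = 1) (hd : 2 * d + f.natDegree ≤ p)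
    (hr : r ∈ degreeLT (ZMod p) d) (hs : s ∈ degreeLT (ZMod p) d)
    (hdvd : X ^ p ∣ r + s * f ^ h) : r = 0 ∧ s = 0 := by
  have hf : f ≠ 0 := by
    rintro rfl
    simp at hf0
  set c := f.eval 0
  have h1 : X ^ p ∣ f * r * r - C c * s * s := by
    have e : f * r * r - C c * s * s =
        (r + s * f ^ h) * ((r - s * f ^ h) * f) + (f ^ p - C c) * (s * s) := by
      have hfp : f ^ p = f ^ (2 * h + 1) := congrArg (f ^ ·) hp
      rw [hfp]
      ring
    rw [e]
    exact dvd_add (hdvd.mul_right _) ((X_pow_dvd_pow_sub_C f).mul_right _)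
  have h2 : f * r * r - C c * s * s = 0 := by
    by_contra hne
    have hdeg : f * r * r - C c * s * s ∈ degreeLT (ZMod p) p := by
      rcases Nat.eq_zero_or_pos d with rfl | hd0
      · rw [mem_degreeLT] at hr hs
        have hr' : r = 0 := by simpa using hr
        have hs' : s = 0 := by simpa using hs
        simp [hr', hs']
      have nd : ∀ q : (ZMod p)[X], q ∈ degreeLT (ZMod p) d → q.natDegree ≤ d := by
        intro q hq
        rw [mem_degreeLT] at hq
        exact natDegree_le_iff_degree_le.mpr hq.le
      refine sub_mem ?_ ?_
      · refine degreeLT_mono (show d + (f.natDegree + d) ≤ p by omega) ?_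
        exact mul_mem_degreeLT (natDegree_mul_le.trans (Nat.add_le_add_left (nd r hr) _)) hr
      · refine degreeLT_mono (show d + d ≤ p by omega) ?_
        exact mul_mem_degreeLT ((natDegree_C_mul_le _ _).trans (nd s hs)) hs
    rw [mem_degreeLT] at hdeg
    have := degree_le_of_dvd h1 hne
    rw [degree_X_pow] at this
    exact absurd hdeg (not_lt.mpr this)
  have h3 : f * (r * r) = C c * (s * s) := by linear_combination h2
  have hc : (C c : (ZMod p)[X]) ≠ 0 := C_ne_zero.mpr hf0
  by_cases hr0 : r = 0
  · refine ⟨hr0, ?_⟩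
    rw [hr0, mul_zero, mul_zero] at h3
    simpa [hf0, c] using h3.symm
  · exfalso
    have hs0 : s ≠ 0 := by
      rintro rfl
      simp [hf, hr0] at h3
    have h4 := congrArg (rootMultiplicity a) h3
    rw [rootMultiplicity_mul (by positivity), rootMultiplicity_mul (by positivity),
      rootMultiplicity_mul (by positivity), rootMultiplicity_mul (by positivity),
      rootMultiplicity_C, ha] at h4
    omega

lemma mul_card_le_natDegree {P : (ZMod p)[X]} (hP : P ≠ 0) {ℓ : ℕ} (hℓ0 : 0 < ℓ) (hℓ : ℓ ≤ p)
    (N : Finset (ZMod p)) (hN : ∀ x ∈ N, ∀ i < ℓ, (derivative^[i] P).eval x = 0) :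
    ℓ * N.card ≤ P.natDegree := by
  have hmul : ∀ x ∈ N, ℓ ≤ P.roots.count x := by
    intro x hx
    rw [count_roots]
    have := lt_rootMultiplicity_of_isRoot_iterate_derivative_of_mem_nonZeroDivisors
      (p := P) (t := x) (n := ℓ - 1) hP (fun i hi => hN x hx i (by omega)) (by
        -- Vanishing derivatives detect multiplicity `ℓ` because `(ℓ - 1)!` is invertible for `ℓ ≤
        -- p`.
        rw [mem_nonZeroDivisors_iff_ne_zero, Ne, ZMod.natCast_eq_zero_iff,
          (Fact.out : p.Prime).dvd_factorial]
        omega)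
    omega
  have hsub : N ⊆ P.roots.toFinset := by
    intro x hx
    rw [Multiset.mem_toFinset, ← Multiset.count_pos]
    exact hℓ0.trans_le (hmul x hx)
  calc ℓ * N.card = ∑ _x ∈ N, ℓ := by rw [Finset.sum_const, smul_eq_mul, mul_comm]
    _ ≤ ∑ x ∈ N, P.roots.count x := Finset.sum_le_sum hmul
    _ ≤ ∑ x ∈ P.roots.toFinset, P.roots.count x := Finset.sum_le_sum_of_subset hsub
    _ = P.roots.card := Multiset.toFinset_sum_count_eq _
    _ ≤ P.natDegree := card_roots' P

/-- Stepanov's bound for the number of `x` at which `f` takes a nonsquare value. -/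
theorem stepanov_bound {f : (ZMod p)[X]} {a : ZMod p} {d h t : ℕ} (hp : p = 2 * h + 1)
    (hf0 : f.eval 0 ≠ 0) (ha : f.rootMultiplicity a = 1) (hd : 2 * d + f.natDegree ≤ p)
    (ht0 : 0 < t) (ht : 2 * t ≤ p)
    (hdt : 2 * t * (d + 2 * t * f.natDegree + t + 1) < 2 * (t + 1) * d)
    (N : Finset (ZMod p)) (hN : ∀ x ∈ N, f.eval x ^ h = -1) :
    2 * t * N.card ≤ 2 * t * f.natDegree + d + h * f.natDegree + p * t := by
  set m := f.natDegree with hm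
  have hf : f ≠ 0 := by
    rintro rfl
    simp at hf0
  let V := Fin (t + 1) → degreeLT (ZMod p) d × degreeLT (ZMod p) d
  have : Module.Finite (ZMod p) (degreeLT (ZMod p) d) := Module.Finite.equiv (degreeLTEquiv (ZMod p) d).symm
  have hfin : Module.finrank (ZMod p) (degreeLT (ZMod p) d) = d := by
    rw [(degreeLTEquiv (ZMod p) d).finrank_eq, Module.finrank_fin_fun]
  let cr : V → Fin (t + 1) → (ZMod p)[X] := fun v j => ((v j).1 : (ZMod p)[X])
  let cs : V → Fin (t + 1) → (ZMod p)[X] := fun v j => ((v j).2 : (ZMod p)[X])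
  let A : ℕ → (ZMod p)[X] →ₗ[ZMod p] (ZMod p)[X] := fun i => weightedDerivativeIter f ((2 * t : ℕ) + 0) i
  let B : ℕ → (ZMod p)[X] →ₗ[ZMod p] (ZMod p)[X] := fun i => weightedDerivativeIter f ((2 * t : ℕ) + (h : ZMod p)) i
  let T : Fin (2 * t) → V →ₗ[ZMod p] (ZMod p)[X] := fun i =>
    { toFun := fun v => ∑ j : Fin (t + 1), X ^ (j : ℕ) * (A i (cr v j) - B i (cs v j))
      map_add' := by
        intro v w
        rw [← Finset.sum_add_distrib]
        refine Finset.sum_congr rfl fun j _ => ?_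
        have h1 : cr (v + w) j = cr v j + cr w j := rfl
        have h2 : cs (v + w) j = cs v j + cs w j := rfl
        rw [h1, h2, map_add, map_add]
        ring
      map_smul' := by
        intro c v
        rw [Finset.smul_sum]
        refine Finset.sum_congr rfl fun j _ => ?_
        have h1 : cr (c • v) j = c • cr v j := rfl
        have h2 : cs (c • v) j = c • cs v j := rfl
        rw [h1, h2, map_smul, map_smul, ← smul_sub, mul_smul_comm, RingHom.id_apply] }
  have hT : ∀ i v, T i v ∈ degreeLT (ZMod p) (d + 2 * t * m + t + 1) := by
    intro i v
    change ∑ j : Fin (t + 1), X ^ (j : ℕ) * (A i (cr v j) - B i (cs v j)) ∈ _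
    refine sum_mem fun j _ => ?_
    refine degreeLT_mono (show d + (i : ℕ) * m + t ≤ _ from ?_) (mul_mem_degreeLT ?_
      (sub_mem (weightedDerivativeIter_mem_degreeLT le_rfl _ (v j).1.2 i)
        (weightedDerivativeIter_mem_degreeLT le_rfl _ (v j).2.2 i)))
    · have := Nat.mul_le_mul_right m i.2.le
      omega
    · rw [natDegree_X_pow]
      omega
  obtain ⟨v, hv0, hv⟩ := exists_ne_zero_forall_eq_zero T hT (by
    rw [Module.finrank_pi_fintype]
    simp only [Module.finrank_prod, hfin, Finset.sum_const, Finset.card_univ, Fintype.card_fin,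
      smul_eq_mul]
    calc _ < 2 * (t + 1) * d := hdt
      _ = _ := by ring)
  -- The factor `f ^ (2 * t)` keeps all derivatives of order below `2 * t` polynomial multiples of
  -- the original powers.
  let P : (ZMod p)[X] := ∑ j : Fin (t + 1), (f ^ (2 * t) * cr v j * X ^ (p * (j : ℕ)) +
    f ^ (2 * t) * cs v j * (f ^ h * X ^ (p * (j : ℕ))))
  have hder : ∀ j : ℕ, derivative (X ^ (p * j) : (ZMod p)[X]) = 0 := by
    intro j
    rw [derivative_X_pow]
    simp
  have hP : P ≠ 0 := by
    intro hP
    have hP' : f ^ (2 * t) * ∑ j : Fin (t + 1),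
        X ^ (p * (j : ℕ)) * (cr v j + cs v j * f ^ h) = 0 := by
      rw [← hP, Finset.mul_sum]
      refine Finset.sum_congr rfl fun j _ => ?_
      ring
    have hsum := (mul_eq_zero.mp hP').resolve_left (pow_ne_zero _ hf)
    have key : ∀ j, X ^ p ∣ cr v j + cs v j * f ^ h → cr v j = 0 ∧ cs v j = 0 := fun j hj =>
      eq_zero_of_X_pow_dvd hp hf0 ha hd (v j).1.2 (v j).2.2 hj
    have hu := eq_zero_of_sum_X_pow_mul_eq_zero (fun j => cr v j + cs v j * f ^ h)
      (fun j hj => by simp [key j hj]) hsum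
    refine hv0 (funext fun j => ?_)
    have := key j (by rw [hu j]; exact dvd_zero _)
    exact Prod.ext (Subtype.ext this.1) (Subtype.ext this.2)
  -- On `N`, `f ^ h = -1` and `x ^ p = x`, so each derivative reduces to a low-degree polynomial
  -- that the choice of `v` made zero.
  have hroots : ∀ x ∈ N, ∀ i < 2 * t, (derivative^[i] P).eval x = 0 := by
    intro x hx i hi
    obtain ⟨k, hk⟩ : ∃ k, 2 * t = k + i := ⟨2 * t - i, by omega⟩
    have hD : derivative^[i] P = ∑ j : Fin (t + 1), (f ^ k * A i (cr v j) * X ^ (p * (j : ℕ)) +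
        f ^ k * B i (cs v j) * (f ^ h * X ^ (p * (j : ℕ)))) := by
      rw [iterate_derivative_sum]
      refine Finset.sum_congr rfl fun j _ => ?_
      rw [iterate_map_add]
      simp only [A, B, hk]
      rw [iterate_derivative_pow_mul (a := 0), iterate_derivative_pow_mul (a := (h : ZMod p))]
      · rw [derivative_mul, hder, derivative_pow]
        rcases Nat.eq_zero_or_pos h with rfl | hh
        · simp
        · obtain ⟨h', rfl⟩ : ∃ h', h = h' + 1 := ⟨h - 1, by omega⟩
          rw [Nat.add_sub_cancel]
          ring
      · rw [hder]
        simp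
    have hTi : ∑ j : Fin (t + 1), x ^ (j : ℕ) * ((A i (cr v j)).eval x - (B i (cs v j)).eval x)
        = 0 := by
      have := congrArg (eval x) (hv ⟨i, hi⟩)
      simpa [T, eval_finsetSum] using this
    rw [hD, eval_finsetSum, ← mul_zero (f.eval x ^ k), ← hTi, Finset.mul_sum]
    refine Finset.sum_congr rfl fun j _ => ?_
    simp only [eval_add, eval_mul, eval_pow, eval_X, hN x hx, pow_mul, ZMod.pow_card]
    ring
  refine (mul_card_le_natDegree hP (by omega) ht N hroots).trans ?_
  have nd : ∀ q : (ZMod p)[X], q ∈ degreeLT (ZMod p) d → q.natDegree ≤ d := by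
    intro q hq
    rw [mem_degreeLT] at hq
    exact natDegree_le_iff_degree_le.mpr hq.le
  refine natDegree_sum_le_of_forall_le _ _ fun j _ => ?_
  have hpow : ∀ k, (f ^ k).natDegree = k * m := fun k => natDegree_pow f k
  have hj : p * (j : ℕ) ≤ p * t := Nat.mul_le_mul_left p (by omega)
  have h1 := nd _ (v j).1.2
  have h2 := nd _ (v j).2.2
  have b1 : (f ^ (2 * t) * cr v j).natDegree ≤ 2 * t * m + d :=
    natDegree_mul_le.trans (Nat.add_le_add (hpow _).le h1)
  have b2 : (f ^ (2 * t) * cs v j).natDegree ≤ 2 * t * m + d :=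
    natDegree_mul_le.trans (Nat.add_le_add (hpow _).le h2)
  have b3 : (f ^ h * X ^ (p * (j : ℕ))).natDegree ≤ h * m + p * t :=
    natDegree_mul_le.trans (Nat.add_le_add (hpow _).le ((natDegree_X_pow _).le.trans hj))
  have b4 : (X ^ (p * (j : ℕ)) : (ZMod p)[X]).natDegree ≤ p * t := (natDegree_X_pow _).le.trans hj
  refine natDegree_add_le_of_degree_le (natDegree_mul_le.trans ?_) (natDegree_mul_le.trans ?_)
  · omega
  · omega

end Stepanov

/-! ### From point counts to character sums -/

section CharacterSum

variable {p : ℕ} [Fact p.Prime]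

lemma le_sum_quadraticChar {h : ℕ} (hp : p = 2 * h + 1) {f : (ZMod p)[X]} (hf : f ≠ 0) :
    (p : ℤ) - 2 * (Finset.univ.filter fun x => f.eval x ^ h = -1).card - f.natDegree ≤
      ∑ x, quadraticChar (ZMod p) (f.eval x) := by
  have hpt : ∀ x : ZMod p, (1 : ℤ) - 2 * (if f.eval x ^ h = -1 then 1 else 0) -
      (if f.eval x = 0 then 1 else 0) ≤ quadraticChar (ZMod p) (f.eval x) := by
    intro x
    by_cases h0 : f.eval x = 0
    · rw [if_pos h0, h0, quadraticChar_zero]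
      split_ifs <;> norm_num
    · rw [if_neg h0]
      rcases quadraticChar_dichotomy h0 with h1 | h1
      · rw [h1]
        split_ifs <;> norm_num
      · have h2 : f.eval x ^ h = -1 := by
          have := quadraticChar_eq_pow_of_char_ne_two' (F := ZMod p) (by
            rw [ZMod.ringChar_zmod_n]
            omega) (f.eval x)
          rw [h1, ZMod.card, show p / 2 = h by omega] at this
          rw [← this]
          norm_num
        rw [if_pos h2, h1]
        norm_num
  have hz : (Finset.univ.filter fun x => f.eval x = 0).card ≤ f.natDegree := by
    refine le_trans (Finset.card_le_card ?_) (f.roots.toFinset_card_le.trans (card_roots' f))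
    intro x hx
    rw [Multiset.mem_toFinset, mem_roots hf]
    exact (Finset.mem_filter.mp hx).2
  refine le_trans ?_ (Finset.sum_le_sum fun x _ => hpt x)
  rw [Finset.sum_sub_distrib, Finset.sum_sub_distrib, ← Finset.mul_sum, Finset.sum_boole,
    Finset.sum_boole, Finset.sum_const, Finset.card_univ, ZMod.card]
  simp only [nsmul_eq_mul, mul_one]
  have : ((Finset.univ.filter fun x => f.eval x = 0).card : ℤ) ≤ f.natDegree := by
    exact_mod_cast hz
  linarith

lemma neg_le_two_pow_mul_sum_quadraticChar {n : ℕ} (hn : 2 ^ (5 * n + 4) < p) {f : (ZMod p)[X]}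
    {a : ZMod p} (hf0 : f.eval 0 ≠ 0) (ha : f.rootMultiplicity a = 1) (hfn : f.natDegree ≤ n) :
    -(p : ℤ) ≤ 2 ^ n * ∑ x, quadraticChar (ZMod p) (f.eval x) := by
  have hf : f ≠ 0 := by
    rintro rfl
    simp at hf0
  have hp2 : p ≠ 2 := by
    have : 2 ^ 1 ≤ 2 ^ (5 * n + 4) := Nat.pow_le_pow_right two_pos (by omega)
    omega
  obtain ⟨h, hp⟩ := (Fact.out : p.Prime).odd_of_ne_two hp2
  set m := f.natDegree with hm
  set q := 2 ^ n with hq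
  have hnq : n + 1 ≤ q := Nat.lt_two_pow_self
  have hqp : 16 * q ^ 5 < p := by
    calc 16 * q ^ 5 = 2 ^ (5 * n + 4) := by
          rw [hq, ← pow_mul, pow_add, mul_comm n 5, mul_comm]
          norm_num
      _ < p := hn
  -- The main error term in the character sum is at most `p * (n + 1) / (2 * t)`; this `t` makes it
  -- `p / (2 * q)`, leaving as much again for the lower-order terms.
  set t := q * (n + 1) with ht
  have ht0 : 0 < t := by positivity
  have htq : t ≤ q ^ 2 := by
    rw [sq]
    exact Nat.mul_le_mul_left q hnq
  have hq1 : 1 ≤ q := by omega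
  have hqk : ∀ k ≤ 5, q ^ k ≤ q ^ 5 := fun k hk => Nat.pow_le_pow_right hq1 hk
  have hbig : t * (2 * t * m + t + 1) ≤ 4 * q ^ 5 := by
    calc t * (2 * t * m + t + 1) ≤ t * (2 * t * n + t + t) := by gcongr; omega
      _ = 2 * (t * t * (n + 1)) := by ring
      _ ≤ 2 * (q ^ 2 * q ^ 2 * q) := by gcongr
      _ = 2 * q ^ 5 := by ring
      _ ≤ 4 * q ^ 5 := by omega
  have hmq : m ≤ q ^ 5 := by
    have := hqk 1 (by norm_num)
    rw [pow_one] at this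
    omega
  have hq5 : 1 ≤ q ^ 5 := Nat.one_le_pow _ _ hq1
  have ht2p : 2 * t ≤ p := by
    have := hqk 2 (by norm_num)
    omega
  have hqnp : 6 * (q * n) ≤ p := by
    have h1 : q * n ≤ q ^ 2 := by
      rw [sq]
      exact Nat.mul_le_mul_left q (by omega)
    have := hqk 2 (by norm_num)
    omega
  set N := Finset.univ.filter fun x => f.eval x ^ h = -1 with hN
  -- This is the largest `d` that the nonvanishing argument allows.
  have hst := stepanov_bound (d := (p - m) / 2) hp hf0 ha (by omega) ht0 ht2p (by
    have h1 : t * (2 * t * m + t + 1) < (p - m) / 2 := by omega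
    generalize (p - m) / 2 = d at h1 ⊢
    rw [← hm]
    nlinarith) N (fun x hx => (Finset.mem_filter.mp hx).2)
  rw [← hm] at hst
  have h2 : (n + 1) * (2 * q * (2 * N.card)) ≤ (n + 1) * (4 * (q * n) + p + 2 * q * p) := by
    have h3 : 2 * ((p - m) / 2) ≤ p := by omega
    have h4 : 2 * (h * m) ≤ p * n := by
      calc 2 * (h * m) = (2 * h) * m := by ring
        _ ≤ p * n := Nat.mul_le_mul (by omega) hfn
    have h5 : t * m ≤ t * n := Nat.mul_le_mul_left t hfn
    calc (n + 1) * (2 * q * (2 * N.card)) = 2 * (2 * t * N.card) := by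
          rw [ht]
          ring
      _ ≤ 2 * (2 * t * m + (p - m) / 2 + h * m + p * t) := Nat.mul_le_mul_left 2 hst
      _ ≤ 4 * (t * n) + p + p * n + 2 * (p * t) := by
          linarith
      _ = (n + 1) * (4 * (q * n) + p + 2 * q * p) := by
          rw [ht]
          ring
  have h6 := Nat.le_of_mul_le_mul_left h2 (Nat.succ_pos n)
  have h7 := le_sum_quadraticChar hp hf
  rw [← hN, ← hm] at h7
  have h8 : (2 ^ n : ℤ) = (q : ℤ) := by
    rw [hq]
    push_cast
    rfl
  rw [h8]
  have h9 : (q : ℤ) * (p - 2 * N.card - m) ≤ q * ∑ x, quadraticChar (ZMod p) (f.eval x) :=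
    mul_le_mul_of_nonneg_left h7 (Int.natCast_nonneg q)
  have h10 : (q : ℤ) * m ≤ q * n :=
    mul_le_mul_of_nonneg_left (by exact_mod_cast hfn) (Int.natCast_nonneg q)
  zify at h6 hqnp
  linarith

lemma neg_le_two_pow_mul_sum_prod_quadraticChar {n : ℕ} (hn : 2 ^ (5 * n + 4) < p)
    {S : Finset (ZMod p)} (hS : S.Nonempty) (h0 : (0 : ZMod p) ∉ S) (hSn : S.card ≤ n) :
    -(p : ℤ) ≤ 2 ^ n * ∑ x, ∏ b ∈ S, quadraticChar (ZMod p) (x - b) := by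
  obtain ⟨a, ha⟩ := hS
  have := neg_le_two_pow_mul_sum_quadraticChar hn (f := ∏ b ∈ S, (X - C b)) (a := a) (by
    rw [eval_prod, Finset.prod_ne_zero_iff]
    intro b hb
    rw [eval_sub, eval_X, eval_C, zero_sub, neg_ne_zero]
    rintro rfl
    exact h0 hb) (by
    rw [← count_roots, roots_prod_X_sub_C]
    exact Multiset.count_eq_one_of_mem S.nodup ha) (by
    rwa [natDegree_finsetProd_X_sub_C_eq_card])
  simpa [eval_prod] using this

/-- For `p` large, some translate of any small set not containing `0` consists of squares. -/
theorem exists_forall_isSquare_sub {n : ℕ} (hn : 2 ^ (5 * n + 4) < p) {B : Finset (ZMod p)}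
    (h0 : (0 : ZMod p) ∉ B) (hB : B.card ≤ n) : ∃ x, ∀ b ∈ B, IsSquare (x - b) := by
  by_contra! hcon
  have hzero : ∑ x, ∏ b ∈ B, (1 + quadraticChar (ZMod p) (x - b)) = 0 := by
    refine Finset.sum_eq_zero fun x _ => ?_
    obtain ⟨b, hb, hx⟩ := hcon x
    refine Finset.prod_eq_zero hb ?_
    rw [quadraticChar_neg_one_iff_not_isSquare.mpr hx]
    norm_num
  simp_rw [Finset.prod_one_add] at hzero
  rw [Finset.sum_comm, ← Finset.add_sum_erase _ _ (Finset.empty_mem_powerset B)] at hzero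
  simp only [Finset.prod_empty, Finset.sum_const, Finset.card_univ, ZMod.card, nsmul_eq_mul,
    mul_one] at hzero
  have hlow : ∑ _S ∈ B.powerset.erase ∅, -(p : ℤ) ≤
      ∑ S ∈ B.powerset.erase ∅, 2 ^ n * ∑ x, ∏ b ∈ S, quadraticChar (ZMod p) (x - b) := by
    refine Finset.sum_le_sum fun S hS => ?_
    rw [Finset.mem_erase, Finset.mem_powerset] at hS
    exact neg_le_two_pow_mul_sum_prod_quadraticChar hn (Finset.nonempty_iff_ne_empty.mpr hS.1)
      (fun h => h0 (hS.2 h)) ((Finset.card_le_card hS.2).trans hB)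
  rw [← Finset.mul_sum, eq_neg_of_add_eq_zero_right hzero, Finset.sum_const, nsmul_eq_mul,
    Finset.card_erase_of_mem (Finset.empty_mem_powerset B), Finset.card_powerset] at hlow
  have hp0 : (0 : ℤ) < p := by exact_mod_cast (Fact.out : p.Prime).pos
  have hcard : ((2 ^ B.card - 1 : ℕ) : ℤ) < 2 ^ n := by
    have h1 : 2 ^ B.card ≤ 2 ^ n := Nat.pow_le_pow_right two_pos hB
    have h2 : 0 < 2 ^ B.card := by positivity
    have h3 : 2 ^ B.card - 1 < 2 ^ n := by omega
    exact_mod_cast h3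
  nlinarith

end CharacterSum

/-! ### The two bounds on the sumset -/

lemma two_pow_lt_of_tower_lt {n p : ℕ} (h : 2 ^ 2 ^ 2 ^ 2 ^ 2 ^ (9 + n) < p) :
    2 ^ (5 * n + 4) < p := by
  refine lt_of_le_of_lt (Nat.pow_le_pow_right two_pos ?_) h
  have h1 : n < 2 ^ n := Nat.lt_two_pow_self
  have h2 : ∀ k : ℕ, k ≤ 2 ^ k := fun k => Nat.lt_two_pow_self.le
  calc 5 * n + 4 ≤ 2 ^ (9 + n) := by
        rw [pow_add]
        omega
    _ ≤ _ := (h2 _).trans ((h2 _).trans (h2 _))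

lemma le_encard_add_of_encard_eq {n p : ℕ} [Fact p.Prime] (hn : 2 * n - 1 ≤ p) (hn1 : 1 ≤ n)
    {A : Set (ZMod p)} (hA : A.encard = n) : ((2 * n - 1 : ℕ) : ℕ∞) ≤ (A + A).encard := by
  classical
  obtain ⟨s, rfl⟩ : ∃ s : Finset (ZMod p), (s : Set (ZMod p)) = A :=
    ⟨A.toFinite.toFinset, A.toFinite.coe_toFinset⟩
  rw [Set.encard_coe_eq_coe_finsetCard, Nat.cast_inj] at hA
  have hs : s.Nonempty := Finset.card_pos.mp (by omega)
  have := ZMod.cauchy_davenport Fact.out hs hs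
  rw [← Finset.coe_add, Set.encard_coe_eq_coe_finsetCard, Nat.cast_le]
  refine le_trans (le_min hn ?_) this
  omega

lemma exists_squareSet_encard_add_le {n p : ℕ} [Fact p.Prime] (hn : 2 ^ (5 * n + 4) < p) :
    ∃ A : Set (ZMod p), A ⊆ squareSet (ZMod p) ∧ A.encard = n ∧
      (A + A).encard ≤ ((2 * n - 1 : ℕ) : ℕ∞) := by
  classical
  have hnp : n < p := by
    have : 5 * n + 4 < 2 ^ (5 * n + 4) := Nat.lt_two_pow_self
    omega
  have hcast : ∀ i, i < n → ((i : ZMod p) + 1) ≠ 0 := by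
    intro i hi h
    have h1 : ((i + 1 : ℕ) : ZMod p) = 0 := by
      push_cast
      exact h
    rw [ZMod.natCast_eq_zero_iff] at h1
    exact absurd (Nat.le_of_dvd (Nat.succ_pos i) h1) (by omega)
  obtain ⟨x, hx⟩ := exists_forall_isSquare_sub hn
    -- Starting at `-1` rather than `0` ensures `0 ∉ B`, that is, `f(0) ≠ 0` in Stepanov's argument.
    (B := (Finset.range n).image fun i : ℕ => -((i : ZMod p) + 1)) (by
      rw [Finset.mem_image]
      rintro ⟨i, hi, h⟩
      exact hcast i (Finset.mem_range.mp hi) (neg_eq_zero.mp h))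
    (Finset.card_image_le.trans (Finset.card_range n).le)
  refine ⟨((Finset.range n).image fun i : ℕ => x + ((i : ZMod p) + 1) : Finset (ZMod p)),
    ?_, ?_, ?_⟩
  · intro y hy
    rw [Finset.mem_coe, Finset.mem_image] at hy
    obtain ⟨i, hi, rfl⟩ := hy
    obtain ⟨c, hc⟩ := hx _ (Finset.mem_image_of_mem _ hi)
    refine ⟨c, ?_⟩
    rw [sq, ← hc, sub_neg_eq_add]
  · rw [Set.encard_coe_eq_coe_finsetCard, Finset.card_image_of_injOn, Finset.card_range]
    intro i hi j hj hij
    rw [Finset.mem_coe, Finset.mem_range] at hi hj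
    have h1 : (i : ZMod p) = j := by simpa using hij
    rw [ZMod.natCast_eq_natCast_iff', Nat.mod_eq_of_lt (hi.trans hnp),
      Nat.mod_eq_of_lt (hj.trans hnp)] at h1
    exact h1
  · rw [← Finset.coe_add, Set.encard_coe_eq_coe_finsetCard, Nat.cast_le]
    have hsub : ((Finset.range n).image fun i : ℕ => x + ((i : ZMod p) + 1)) +
        ((Finset.range n).image fun i : ℕ => x + ((i : ZMod p) + 1)) ⊆
        (Finset.range (2 * n - 1)).image fun j : ℕ => 2 * x + 2 + (j : ZMod p) := by
      intro y hy
      obtain ⟨u, hu, v, hv, rfl⟩ := Finset.mem_add.mp hy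
      obtain ⟨i, hi, rfl⟩ := Finset.mem_image.mp hu
      obtain ⟨j, hj, rfl⟩ := Finset.mem_image.mp hv
      rw [Finset.mem_range] at hi hj
      refine Finset.mem_image.mpr ⟨i + j, Finset.mem_range.mpr (by omega), ?_⟩
      push_cast
      ring
    exact (Finset.card_le_card hsub).trans (Finset.card_image_le.trans (Finset.card_range _).le)

end StepanovSquares

open StepanovSquares in
theorem mainTheorem5 (n : ℕ) (hn : 1 ≤ n) (p : ℕ) (hp : p.Prime)
    (hlarge : 2 ^ 2 ^ 2 ^ 2 ^ 2 ^ (9 + n) < p) :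
    minSumsetOfSquares n (ZMod p) = ((2 * n - 1 : ℕ) : ℕ∞) := by
  have : Fact p.Prime := ⟨hp⟩
  have hpn := two_pow_lt_of_tower_lt hlarge
  have hnp : 5 * n + 4 < 2 ^ (5 * n + 4) := Nat.lt_two_pow_self
  refine le_antisymm ?_ ?_
  · obtain ⟨A, hA, hcard, hadd⟩ := exists_squareSet_encard_add_le hpn
    exact (iInf₂_le A ⟨hA, hcard⟩).trans hadd
  · exact le_iInf₂ fun A hA => le_encard_add_of_encard_eq (by omega) hn hA.2
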